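/- \textbf{Setting.} Let $X,Y$ be Polish spaces, let $\mu$ and $\nu$ be Borel probability measures on $X$ and $Y$, and let $c:X\times Y\to[0,\infty)$ be continuous. A transport plan is a measure $\pi$ on $X\times Y$ with marginals $\mu$ and $\nu$; put $T_c(\mu,\nu)=\inf_\pi\int c\,d\pi$, the infimum running over all transport plans, and call a plan optimal if it attains this infimum. For $f:X\to\mathbb R\cup\{-\infty\}$ and $g:Y\to\mathbb R\cup\{-\infty\}$ let $f^c(y)=\inf_{x\in X}\big(c(x,y)-f(x)\big)$ and $g^c(x)=\inf_{y\in Y}\big(c(x,y)-g(y)\big)$. A function $f:X\to\mathbb R\cup\{-\infty\}$ is $c$-concave if $f=g^c$ for some $g:Y\to\mathbb R\cup\{-\infty\}$ and $f\not\equiv-\infty$. The set $S_c(\mu,\nu)$ of Kantorovich potentials consists of the $c$-concave $f$ for which there is an optimal plan $\pi$ with $$T_c(\mu,\nu)=\int c\,d\pi=\int\big(f(x)+f^c(y)\big)\,d\pi(x,y).$$ They are called almost surely unique if for all $f_1,f_2\in S_c(\mu,\nu)$ the difference $f_1-f_2$ is $\mu$-almost surely equal to a real constant. For an optimal plan $\pi$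 and a closed set $A\subset X$ with $\mu(A)>0$, the $A$-restricted problem with respect to $\pi$ is the transport problem on $A\times Y$ between $\mu_A=\mu|_A/\mu(A)$ and $\nu_A=\pi(A\times\cdot)/\mu(A)$ with cost $c_A=c|_{A\times Y}$. Let $(X_i)_{i\in I}$ and $(Y_j)_{j\in J}$ be the (distinct) connected components of $\operatorname{supp}\mu$ and $\operatorname{supp}\nu$. A transport plan $\pi$ is degenerate if there are $I'\subset I$ and $J'\subset J$ with $$0<\sum_{i\in I'}\mu(X_i)=\sum_{i\in I'}\sum_{j\in J'}\pi(X_i\times Y_j)=\sum_{j\in J'}\nu(Y_j)<1 .$$ \textbf{Theorem (Uniqueness under disconnected support).} In this setting let $T_c(\mu,\nu)<\infty$, let $I$ be finite and $J$ at most countable. Assume that for every $f\in S_c(\mu,\nu)$ at least one of the following holds: \begin{enumerate} \item $f^c|_{\operatorname{supp}\nu}$ is real-valued and continuous; \item for all $j\in J$ with $\nu(Y_j)>0$, $f^c|_{Y_j}$ is real-valued and continuous and $\operatorname{supp}(\nu|_{Y_j})$ is connected. \end{enumerate} If there exists a non-degenerate optimal transport plan $\pi$ between $\mu$ and $\nu$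 such that, for every $i\in I$, the Kantorovich potentials $S_{c_{X_i}}(\mu_{X_i},\nu_{X_i})$ of the $X_i$-restricted problem with respect to $\pi$ are almost surely unique, then the Kantorovich potentials $S_c(\mu,\nu)$ are almost surely unique. -/

import Mathlib

open MeasureTheory Set Topology
open scoped ENNReal NNReal

namespace OptTransport

section Transport

variable {X : Type*} {Y : Type*} [MeasurableSpace X] [MeasurableSpace Y]

/-- `π` is a transport plan between `μ` and `ν`: its marginals are `μ` and `ν`. -/
def IsPlan (μ : Measure X) (ν : Measure Y) (π : Measure (X × Y)) : Prop :=
  π.fst = μ ∧ π.snd = ν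

/-- The optimal transport cost `T_c(μ, ν) = inf_π ∫ c dπ`, the infimum running over all
transport plans. -/
noncomputable def transportCost (c : X × Y → ℝ≥0) (μ : Measure X) (ν : Measure Y) : ℝ≥0∞ :=
  ⨅ (π : Measure (X × Y)) (_ : IsPlan μ ν π), ∫⁻ z, (c z : ℝ≥0∞) ∂π

/-- `π` is an optimal transport plan between `μ` and `ν`. -/
def IsOptimalPlan (c : X × Y → ℝ≥0) (μ : Measure X) (ν : Measure Y)
    (π : Measure (X × Y)) : Prop :=
  IsPlan μ ν π ∧ ∫⁻ z, (c z : ℝ≥0∞) ∂π = transportCost c μ ν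

/-- Integral of an extended real function, as the integral of its positive part minus the
integral of its negative part. -/
noncomputable def extIntegral {Z : Type*} [MeasurableSpace Z] (π : Measure Z) (h : Z → EReal) :
    EReal :=
  ((∫⁻ z, (h z).toENNReal ∂π : ℝ≥0∞) : EReal) - ((∫⁻ z, (-(h z)).toENNReal ∂π : ℝ≥0∞) : EReal)

/-- The `c`-transform `f^c(y) = inf_x (c(x, y) - f(x))` of a function `f` on `X`. -/
noncomputable def cTransform (c : X × Y → ℝ≥0) (f : X → EReal) (y : Y) : EReal :=
  ⨅ x : X, (((c (x, y) : ℝ) : EReal) - f x)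

/-- The `c`-transform `g^c(x) = inf_y (c(x, y) - g(y))` of a function `g` on `Y`. -/
noncomputable def cTransform' (c : X × Y → ℝ≥0) (g : Y → EReal) (x : X) : EReal :=
  ⨅ y : Y, (((c (x, y) : ℝ) : EReal) - g y)

/-- `f : X → ℝ ∪ {-∞}` is `c`-concave: it is the `c`-transform of some
`g : Y → ℝ ∪ {-∞}` and it is not equal to `-∞` everywhere. -/
def IsCConcave (c : X × Y → ℝ≥0) (f : X → EReal) : Prop :=
  (∀ x, f x ≠ ⊤) ∧ (∃ x, f x ≠ ⊥) ∧ ∃ g : Y → EReal, (∀ y, g y ≠ ⊤) ∧ f = cTransform' c g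

/-- The (generalized) Kantorovich potentials: `c`-concave functions `f` on `X` such that
`T_c(μ, ν) = ∫ c dπ = ∫ (f(x) + f^c(y)) dπ(x, y)` for some optimal transport plan `π`. -/
def kantorovichPotentials (c : X × Y → ℝ≥0) (μ : Measure X) (ν : Measure Y) :
    Set (X → EReal) :=
  {f | IsCConcave c f ∧ ∃ π : Measure (X × Y), IsOptimalPlan c μ ν π ∧
    extIntegral π (fun z => f z.1 + cTransform c f z.2) = (transportCost c μ ν : EReal)}

/-- The Kantorovich potentials are almost surely unique (up to constant shifts): the difference
of any two of them is `μ`-almost surely equal to a real constant. -/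
def PotentialsAEUnique (c : X × Y → ℝ≥0) (μ : Measure X) (ν : Measure Y) : Prop :=
  ∀ f₁ ∈ kantorovichPotentials c μ ν, ∀ f₂ ∈ kantorovichPotentials c μ ν,
    ∃ a : ℝ, ∀ᵐ x ∂μ, f₁ x - f₂ x = (a : EReal)

/-- The cost function restricted to `A × Y`. -/
def restrictedCost (c : X × Y → ℝ≥0) (A : Set X) : A × Y → ℝ≥0 :=
  fun z => c (z.1, z.2)

/-- The probability measure `μ|_A / μ(A)`, as a measure on the space `A`. -/
noncomputable def restrictedSource (μ : Measure X) (A : Set X) : Measure A :=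
  (μ A)⁻¹ • μ.comap (Subtype.val : A → X)

/-- The probability measure `π(A × ·) / μ(A)` on `Y`. -/
noncomputable def restrictedTarget (μ : Measure X) (π : Measure (X × Y)) (A : Set X) :
    Measure Y :=
  (μ A)⁻¹ • (π.restrict (A ×ˢ univ)).snd

/-- The Kantorovich potentials of the `A`-restricted transport problem with respect to `π`
are almost surely unique. -/
def RestrictedPotentialsAEUnique (c : X × Y → ℝ≥0) (μ : Measure X) (π : Measure (X × Y))
    (A : Set X) : Prop :=
  PotentialsAEUnique (restrictedCost c A) (restrictedSource μ A) (restrictedTarget μ π A)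

/-- Given the pieces `C i` and `D j` of the two supports, `π` is degenerate: some index sets
`I'`, `J'` satisfy
`0 < ∑_{I'} μ(C i) = ∑_{I'} ∑_{J'} π(C i × D j) = ∑_{J'} ν(D j) < 1`. -/
def IsDegenerate {ι κ : Type*} (μ : Measure X) (ν : Measure Y) (C : ι → Set X) (D : κ → Set Y)
    (π : Measure (X × Y)) : Prop :=
  ∃ (I' : Set ι) (J' : Set κ),
    0 < ∑' i : I', μ (C i) ∧
    ∑' i : I', μ (C i) = ∑' i : I', ∑' j : J', π (C i ×ˢ D j) ∧
    ∑' i : I', ∑' j : J', π (C i ×ˢ D j) = ∑' j : J', ν (D j) ∧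
    ∑' j : J', ν (D j) < 1

end Transport

/-- `C` enumerates, without repetition, the connected components of the set `S`. -/
def IsComponentDecomposition {Z ι : Type*} [TopologicalSpace Z] (S : Set Z) (C : ι → Set Z) :
    Prop :=
  Function.Injective C ∧ range C = {A | ∃ x ∈ S, A = connectedComponentIn S x}

/-- The restriction of the extended real function `g` to `S` is a continuous real-valued
function. -/
def IsRealContinuousOn {Z : Type*} [TopologicalSpace Z] (g : Z → EReal) (S : Set Z) : Prop :=
  (∀ y ∈ S, g y ≠ ⊥ ∧ g y ≠ ⊤) ∧ ContinuousOn g S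

end OptTransport

/-! Complementary slackness drives everything: a potential `f` satisfies `f(x) + f^c(y) = c(x, y)`
almost everywhere under every optimal plan (`ae_add_cTransform_eq`). Hence `f` restricts to a
potential of each `X_i`-restricted problem, and by the assumed uniqueness two potentials differ on
`X_i` by a constant `a_i`. Slackness carries this over to `Y`: for `π`-almost every `(x, y)` with `x
∈ X_i`, the difference `d = f₁^c - f₂^c` equals `-a_i` at `y`.

There are finitely many `X_i`, so `d` takes almost surely finitely many values. Continuity and
connectedness then make it constant, say `b_j`, almost everywhere on each `Y_j`
(`exists_eq_const_of_ae_mem_finite`). If `π` moves mass from `X_i` to `Y_j`, then `a_i = -b_j`.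
Pieces sharing one label therefore exchange mass only among themselves, and non-degeneracy leaves a
single label (`exists_ae_label_eq_of_not_isDegenerate`).

Since `f` and `f^c` need not be separately integrable, the duality statements are proved by
truncation. -/

namespace OptTransport

open Filter

/-! ### Truncation of extended real functions -/

section Truncation

/-- The truncation of an extended real number to the interval `[-n, n]`. -/
noncomputable def truncate (n : ℕ) (a : EReal) : ℝ :=
  (max (((-n : ℝ)) : EReal) (min ((n : ℝ) : EReal) a)).toReal

lemma truncate_bot (n : ℕ) : truncate n ⊥ = -n := by
  rw [truncate, min_eq_right bot_le, max_eq_left bot_le, EReal.toReal_coe]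

lemma truncate_top (n : ℕ) : truncate n ⊤ = n := by
  have h : (((-n : ℝ)) : EReal) ≤ ((n : ℝ) : EReal) :=
    EReal.coe_le_coe_iff.2 (by linarith [n.cast_nonneg (α := ℝ)])
  rw [truncate, min_eq_left le_top, max_eq_right h, EReal.toReal_coe]

lemma truncate_coe (n : ℕ) (x : ℝ) : truncate n x = max (-n : ℝ) (min (n : ℝ) x) := by
  rw [truncate, ← EReal.coe_strictMono.monotone.map_min, ← EReal.coe_strictMono.monotone.map_max,
    EReal.toReal_coe]

lemma abs_truncate_le (n : ℕ) (a : EReal) : |truncate n a| ≤ n := by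
  have hn : (0 : ℝ) ≤ n := n.cast_nonneg
  induction a with
  | bot => rw [truncate_bot, abs_neg, abs_of_nonneg hn]
  | top => rw [truncate_top, abs_of_nonneg hn]
  | coe x =>
    rw [truncate_coe, abs_le]
    exact ⟨le_max_left _ _, max_le (by linarith) (min_le_left _ _)⟩

lemma measurable_truncate (n : ℕ) : Measurable (truncate n) :=
  (measurable_const.max (measurable_const.min measurable_id)).ereal_toReal

/-- Truncation raises only values below `-n`; when it does so to one summand, the truncated sum is
at most `-n + n = 0 ≤ r`. -/
lemma truncate_add_truncate_le {a b : EReal} {r : ℝ} (hr : 0 ≤ r) (ha : a ≠ ⊤) (hb : b ≠ ⊤)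
    (h : a + b ≤ r) (n : ℕ) : truncate n a + truncate n b ≤ r := by
  have hA := abs_le.1 (abs_truncate_le n a)
  have hB := abs_le.1 (abs_truncate_le n b)
  induction a with
  | bot => rw [truncate_bot]; linarith
  | top => exact absurd rfl ha
  | coe x =>
    induction b with
    | bot => rw [truncate_bot]; linarith
    | top => exact absurd rfl hb
    | coe y =>
      have h' : x + y ≤ r := by exact_mod_cast h
      rw [truncate_coe, truncate_coe]
      grind

/-- Truncation is monotone and odd, so it preserves `-y ≤ x`. -/
lemma truncate_add_truncate_nonneg {x y : ℝ} (h : 0 ≤ x + y) (n : ℕ) :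
    0 ≤ truncate n x + truncate n y := by
  rw [truncate_coe, truncate_coe]
  grind

lemma tendsto_truncate (x : ℝ) : Tendsto (fun n => truncate n x) atTop (𝓝 x) := by
  obtain ⟨N, hN⟩ := exists_nat_ge |x|
  refine tendsto_const_nhds.congr' ?_
  filter_upwards [eventually_ge_atTop N] with n hn
  have hn' : (N : ℝ) ≤ n := by exact_mod_cast hn
  have := abs_le.1 (hN.trans hn')
  rw [truncate_coe, min_eq_right this.2, max_eq_right this.1]

lemma eventually_truncate_le {a : EReal} {p : ℝ} (h : a < p) :
    ∀ᶠ n in atTop, truncate n a ≤ p := by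
  obtain ⟨N, hN⟩ := exists_nat_ge (-p)
  filter_upwards [eventually_ge_atTop N] with n hn
  have hn' : (N : ℝ) ≤ n := by exact_mod_cast hn
  induction a with
  | bot => rw [truncate_bot]; linarith
  | top => exact absurd h (not_lt.2 le_top)
  | coe x =>
    have : x < p := by exact_mod_cast h
    rw [truncate_coe]
    exact max_le (by linarith) ((min_le_right _ _).trans this.le)

/-- A strict inequality leaves a gap uniform in `n`, even if `a` or `b` is `-∞`; this keeps the
liminf positive in the Fatou argument. -/
lemma exists_eventually_truncate_add_le {a b : EReal} {r : ℝ} (ha : a ≠ ⊤) (hb : b ≠ ⊤)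
    (h : a + b < r) : ∃ ε > 0, ∀ᶠ n in atTop, ε ≤ r - (truncate n a + truncate n b) := by
  have : ∃ p : ℝ, a < p ∧ ∃ q : ℝ, b < q ∧ p + q < r := by
    by_contra! hcon
    refine absurd h (not_lt.2 (EReal.le_add_of_forall_gt (Or.inr hb) (Or.inl ha) ?_))
    intro a' ha' b' hb'
    obtain ⟨p, hp, hpa⟩ := EReal.lt_iff_exists_real_btwn.1 ha'
    obtain ⟨q, hq, hqb⟩ := EReal.lt_iff_exists_real_btwn.1 hb'
    have h1 : ((r : ℝ) : EReal) ≤ ((p + q : ℝ) : EReal) :=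
      EReal.coe_le_coe_iff.2 (hcon p hp q hq)
    rw [EReal.coe_add] at h1
    exact h1.trans (add_le_add hpa.le hqb.le)
  obtain ⟨p, hp, q, hq, hpq⟩ := this
  refine ⟨r - (p + q), by linarith, ?_⟩
  filter_upwards [eventually_truncate_le hp, eventually_truncate_le hq] with n h1 h2
  linarith

end Truncation

/-! ### Complementary slackness and optimality by truncation -/

section Duality

variable {X : Type*} {Y : Type*} [MeasurableSpace X] [MeasurableSpace Y]

lemma integrable_truncate_comp {Z : Type*} [MeasurableSpace Z] {π : Measure Z} [IsFiniteMeasure π]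
    {φ : Z → EReal} (hφ : Measurable φ) (n : ℕ) : Integrable (fun z => truncate n (φ z)) π :=
  Integrable.of_bound ((measurable_truncate n).comp hφ).aestronglyMeasurable n
    (Eventually.of_forall fun z => abs_truncate_le n (φ z))

/-- Bounded summands can be integrated separately, and each integral sees only a marginal. -/
lemma integral_truncate_add_truncate_eq {π π' : Measure (X × Y)} [IsFiniteMeasure π]
    [IsFiniteMeasure π'] (h₁ : π.fst = π'.fst) (h₂ : π.snd = π'.snd) {φ : X → EReal}
    {ψ : Y → EReal} (hφ : Measurable φ) (hψ : Measurable ψ) (n : ℕ) :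
    ∫ z, truncate n (φ z.1) + truncate n (ψ z.2) ∂π =
      ∫ z, truncate n (φ z.1) + truncate n (ψ z.2) ∂π' := by
  have key : ∀ (ρ : Measure (X × Y)) [IsFiniteMeasure ρ],
      ∫ z, truncate n (φ z.1) + truncate n (ψ z.2) ∂ρ =
        ∫ x, truncate n (φ x) ∂ρ.fst + ∫ y, truncate n (ψ y) ∂ρ.snd := by
    intro ρ _
    have hi₁ : Integrable (fun z : X × Y => truncate n (φ z.1)) ρ :=
      integrable_truncate_comp (hφ.comp measurable_fst) n
    have hi₂ : Integrable (fun z : X × Y => truncate n (ψ z.2)) ρ :=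
      integrable_truncate_comp (hψ.comp measurable_snd) n
    have hm₁ : Measurable fun x => truncate n (φ x) := (measurable_truncate n).comp hφ
    have hm₂ : Measurable fun y => truncate n (ψ y) := (measurable_truncate n).comp hψ
    rw [integral_add hi₁ hi₂, Measure.fst, Measure.snd,
      integral_map measurable_fst.aemeasurable hm₁.aestronglyMeasurable,
      integral_map measurable_snd.aemeasurable hm₂.aestronglyMeasurable]
  rw [key, key, h₁, h₂]

variable {c : X × Y → ℝ≥0} {φ : X → EReal} {ψ : Y → EReal} {π π' : Measure (X × Y)}

lemma integrable_cost (hc : Measurable c) (h : ∫⁻ z, (c z : ℝ≥0∞) ∂π ≠ ∞) :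
    Integrable (fun z => (c z : ℝ)) π := by
  refine ⟨hc.coe_nnreal_real.aestronglyMeasurable, ?_⟩
  rw [HasFiniteIntegral]
  convert h.lt_top using 3 with z
  simp

/-- If `φ ⊕ ψ ≤ c` with equality almost surely under the plan `π`, then the integrals of the
truncations of `φ ⊕ ψ` under any plan with the same marginals converge to `∫ c dπ`. -/
lemma tendsto_integral_truncate [IsFiniteMeasure π] [IsFiniteMeasure π'] (hc : Measurable c)
    (hφ : Measurable φ) (hψ : Measurable ψ) (h₁ : π.fst = π'.fst) (h₂ : π.snd = π'.snd)
    (hφt : ∀ x, φ x ≠ ⊤) (hψt : ∀ y, ψ y ≠ ⊤)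
    (heq : ∀ᵐ z ∂π, φ z.1 + ψ z.2 = ((c z : ℝ) : EReal)) (hfin : ∫⁻ z, (c z : ℝ≥0∞) ∂π ≠ ∞) :
    Tendsto (fun n => ∫ z, truncate n (φ z.1) + truncate n (ψ z.2) ∂π') atTop
      (𝓝 (∫ z, (c z : ℝ) ∂π)) := by
  simp_rw [← integral_truncate_add_truncate_eq h₁ h₂ hφ hψ]
  have hreal : ∀ᵐ z ∂π, ∃ x y : ℝ, φ z.1 = x ∧ ψ z.2 = y ∧ x + y = c z := by
    filter_upwards [heq] with z hz
    have hx : φ z.1 ≠ ⊥ := fun h => by simp [h] at hz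
    have hy : ψ z.2 ≠ ⊥ := fun h => by simp [h] at hz
    refine ⟨_, _, (EReal.coe_toReal (hφt _) hx).symm, (EReal.coe_toReal (hψt _) hy).symm, ?_⟩
    rw [← EReal.toReal_add (hφt _) hx (hψt _) hy, hz, EReal.toReal_coe]
  -- Where `φ ⊕ ψ = c ≥ 0`, the truncated sums lie between `0` and `c`.
  refine tendsto_integral_of_dominated_convergence (fun z => (c z : ℝ))
    (fun n => ((integrable_truncate_comp (hφ.comp measurable_fst) n).add
      (integrable_truncate_comp (hψ.comp measurable_snd) n)).aestronglyMeasurable)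
    (integrable_cost hc hfin) (fun n => ?_) ?_
  · filter_upwards [hreal] with z ⟨x, y, hx, hy, hxy⟩
    rw [hx, hy, Real.norm_eq_abs, abs_of_nonneg
      (truncate_add_truncate_nonneg (by rw [hxy]; exact (c z).coe_nonneg) n)]
    exact truncate_add_truncate_le (c z).coe_nonneg (by simp) (by simp)
      (by exact_mod_cast hxy.le) n
  · filter_upwards [hreal] with z ⟨x, y, hx, hy, hxy⟩
    rw [hx, hy, ← hxy]
    exact (tendsto_truncate x).add (tendsto_truncate y)

/-- Complementary slackness implies optimality. -/
lemma lintegral_cost_le_of_ae_eq [IsFiniteMeasure π] [IsFiniteMeasure π'] (hc : Measurable c)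
    (hφ : Measurable φ) (hψ : Measurable ψ) (h₁ : π.fst = π'.fst) (h₂ : π.snd = π'.snd)
    (hφt : ∀ x, φ x ≠ ⊤) (hψt : ∀ y, ψ y ≠ ⊤) (hle : ∀ x y, φ x + ψ y ≤ ((c (x, y) : ℝ) : EReal))
    (heq : ∀ᵐ z ∂π, φ z.1 + ψ z.2 = ((c z : ℝ) : EReal)) (hfin : ∫⁻ z, (c z : ℝ≥0∞) ∂π ≠ ∞) :
    ∫⁻ z, (c z : ℝ≥0∞) ∂π ≤ ∫⁻ z, (c z : ℝ≥0∞) ∂π' := by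
  by_cases hfin' : ∫⁻ z, (c z : ℝ≥0∞) ∂π' = ∞
  · rw [hfin']; exact le_top
  have hI := integrable_cost hc hfin
  have hI' := integrable_cost hc hfin'
  have hlim : ∫ z, (c z : ℝ) ∂π ≤ ∫ z, (c z : ℝ) ∂π' := by
    refine le_of_tendsto' (tendsto_integral_truncate hc hφ hψ h₁ h₂ hφt hψt heq hfin) fun n => ?_
    exact integral_mono ((integrable_truncate_comp (hφ.comp measurable_fst) n).add
      (integrable_truncate_comp (hψ.comp measurable_snd) n)) hI' fun z =>
        truncate_add_truncate_le (c z).coe_nonneg (hφt _) (hψt _) (hle _ _) n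
  have := ENNReal.ofReal_le_ofReal hlim
  rw [ofReal_integral_eq_lintegral_ofReal hI (Eventually.of_forall fun z => (c z).coe_nonneg),
    ofReal_integral_eq_lintegral_ofReal hI' (Eventually.of_forall fun z => (c z).coe_nonneg)] at this
  simpa using this

/-- Complementary slackness for one plan implies complementary slackness for every plan with the
same marginals and the same cost. -/
lemma ae_eq_cost_of_ae_eq_cost [IsFiniteMeasure π] [IsFiniteMeasure π'] (hc : Measurable c)
    (hφ : Measurable φ) (hψ : Measurable ψ) (h₁ : π.fst = π'.fst) (h₂ : π.snd = π'.snd)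
    (hφt : ∀ x, φ x ≠ ⊤) (hψt : ∀ y, ψ y ≠ ⊤) (hle : ∀ x y, φ x + ψ y ≤ ((c (x, y) : ℝ) : EReal))
    (heq : ∀ᵐ z ∂π, φ z.1 + ψ z.2 = ((c z : ℝ) : EReal)) (hfin : ∫⁻ z, (c z : ℝ≥0∞) ∂π ≠ ∞)
    (hcost : ∫⁻ z, (c z : ℝ≥0∞) ∂π' = ∫⁻ z, (c z : ℝ≥0∞) ∂π) :
    ∀ᵐ z ∂π', φ z.1 + ψ z.2 = ((c z : ℝ) : EReal) := by
  have hfin' : ∫⁻ z, (c z : ℝ≥0∞) ∂π' ≠ ∞ := hcost ▸ hfin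
  have hI' := integrable_cost hc hfin'
  have hint : ∀ n, Integrable (fun z : X × Y => truncate n (φ z.1) + truncate n (ψ z.2)) π' :=
    fun n => (integrable_truncate_comp (hφ.comp measurable_fst) n).add
      (integrable_truncate_comp (hψ.comp measurable_snd) n)
  have hIeq : ∫ z, (c z : ℝ) ∂π' = ∫ z, (c z : ℝ) ∂π := by
    rw [integral_eq_lintegral_of_nonneg_ae (Eventually.of_forall fun z => (c z).coe_nonneg)
      hc.coe_nnreal_real.aestronglyMeasurable, integral_eq_lintegral_of_nonneg_ae
      (Eventually.of_forall fun z => (c z).coe_nonneg) hc.coe_nnreal_real.aestronglyMeasurable]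
    simp [hcost]
  -- The truncated slack is nonnegative, and its `π'`-integral tends to `∫ c dπ' - ∫ c dπ = 0`. By
  -- Fatou its liminf vanishes almost everywhere.
  let F : ℕ → X × Y → ℝ≥0∞ := fun n z =>
    ENNReal.ofReal (c z - (truncate n (φ z.1) + truncate n (ψ z.2)))
  have hFm : ∀ n, Measurable (F n) := fun n =>
    (hc.coe_nnreal_real.sub (((measurable_truncate n).comp (hφ.comp measurable_fst)).add
      ((measurable_truncate n).comp (hψ.comp measurable_snd)))).ennreal_ofReal
  have hFint : ∀ n, ∫⁻ z, F n z ∂π' = ENNReal.ofReal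
      (∫ z, (c z : ℝ) ∂π' - ∫ z, truncate n (φ z.1) + truncate n (ψ z.2) ∂π') := by
    intro n
    rw [← integral_sub hI' (hint n)]
    refine (ofReal_integral_eq_lintegral_ofReal (hI'.sub (hint n)) ?_).symm
    exact Eventually.of_forall fun z => sub_nonneg.2
      (truncate_add_truncate_le (c z).coe_nonneg (hφt _) (hψt _) (hle _ _) n)
  have hlim : Tendsto (fun n => ∫⁻ z, F n z ∂π') atTop (𝓝 0) := by
    simp_rw [hFint]
    have := (ENNReal.continuous_ofReal.tendsto _).comp
      ((tendsto_const_nhds (x := ∫ z, (c z : ℝ) ∂π')).sub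
        (tendsto_integral_truncate hc hφ hψ h₁ h₂ hφt hψt heq hfin))
    rwa [hIeq, sub_self, ENNReal.ofReal_zero, ← hIeq] at this
  have hzero : ∫⁻ z, liminf (fun n => F n z) atTop ∂π' = 0 := by
    refine le_antisymm ((lintegral_liminf_le hFm).trans ?_) zero_le
    rw [hlim.liminf_eq]
  rw [lintegral_eq_zero_iff (Measurable.liminf hFm)] at hzero
  filter_upwards [hzero] with z hz
  by_contra hne
  obtain ⟨ε, hε, hev⟩ := exists_eventually_truncate_add_le (hφt z.1) (hψt z.2)
    (lt_of_le_of_ne (hle z.1 z.2) hne)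
  have : ENNReal.ofReal ε ≤ liminf (fun n => F n z) atTop :=
    le_liminf_of_le (by isBoundedDefault) (hev.mono fun n hn => ENNReal.ofReal_le_ofReal hn)
  rw [hz] at this
  exact absurd (ENNReal.ofReal_eq_zero.1 (le_antisymm this zero_le)) (not_le.2 hε)

end Duality

/-! ### The `c`-transform -/

section Potentials

variable {X : Type*} {Y : Type*} {c : X × Y → ℝ≥0} {f : X → EReal}

lemma cTransform_ne_top (hf : ∃ x, f x ≠ ⊥) (y : Y) : cTransform c f y ≠ ⊤ := by
  obtain ⟨x, hx⟩ := hf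
  refine ne_top_of_le_ne_top ?_ (iInf_le _ x)
  rw [sub_eq_add_neg]
  exact EReal.add_ne_top (EReal.coe_ne_top _) (by simpa using hx)

lemma add_cTransform_le (c : X × Y → ℝ≥0) (f : X → EReal) (x : X) (y : Y) :
    f x + cTransform c f y ≤ ((c (x, y) : ℝ) : EReal) := by
  rw [add_comm]
  exact EReal.add_le_of_le_sub (iInf_le _ x)

lemma continuous_coe_sub_const {Z : Type*} [TopologicalSpace Z] {h : Z → ℝ} (hh : Continuous h)
    (a : EReal) : Continuous fun z => ((h z : ℝ) : EReal) - a := by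
  induction a with
  | bot => simpa using continuous_const
  | top => simpa using continuous_const
  | coe a => exact_mod_cast continuous_coe_real_ereal.comp (hh.sub continuous_const)

variable [TopologicalSpace X] [TopologicalSpace Y]

/-- An arbitrary infimum of continuous functions is upper semicontinuous, hence Borel. -/
lemma measurable_cTransform [MeasurableSpace Y] [BorelSpace Y] (hc : Continuous c) (f : X → EReal) :
    Measurable (cTransform c f) :=
  (upperSemicontinuous_iInf fun x => (continuous_coe_sub_const (h := fun y => (c (x, y) : ℝ))
    (by fun_prop) (f x)).upperSemicontinuous).measurable

lemma measurable_cTransform' [MeasurableSpace X] [BorelSpace X] (hc : Continuous c) (g : Y → EReal) :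
    Measurable (cTransform' c g) :=
  (upperSemicontinuous_iInf fun y => (continuous_coe_sub_const (h := fun x => (c (x, y) : ℝ))
    (by fun_prop) (g y)).upperSemicontinuous).measurable

lemma IsCConcave.measurable [MeasurableSpace X] [BorelSpace X] (hc : Continuous c) (hf : IsCConcave c f) :
    Measurable f := by
  obtain ⟨g, -, rfl⟩ := hf.2.2
  exact measurable_cTransform' hc g

end Potentials

/-! ### Equality in the extended integral -/

section ExtIntegral

variable {Z : Type*} [MeasurableSpace Z] {π : Measure Z} {c : Z → ℝ≥0} {h : Z → EReal}

lemma extIntegral_eq_of_ae_eq (heq : ∀ᵐ z ∂π, h z = ((c z : ℝ) : EReal)) :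
    extIntegral π h = ((∫⁻ z, (c z : ℝ≥0∞) ∂π : ℝ≥0∞) : EReal) := by
  have h₁ : ∫⁻ z, (h z).toENNReal ∂π = ∫⁻ z, (c z : ℝ≥0∞) ∂π :=
    lintegral_congr_ae (by filter_upwards [heq] with z hz; simp [hz])
  have h₂ : ∫⁻ z, (-(h z)).toENNReal ∂π = 0 := by
    rw [← lintegral_zero (μ := π)]
    refine lintegral_congr_ae ?_
    filter_upwards [heq] with z hz
    rw [hz]
    exact EReal.toENNReal_of_nonpos (by simp)
  rw [extIntegral, h₁, h₂]
  simp

lemma eq_and_eq_zero_of_coe_sub_coe_eq {P N T : ℝ≥0∞} (hP : P ≤ T) (hT : T ≠ ∞)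
    (h : (P : EReal) - N = T) : P = T ∧ N = 0 := by
  have hN : N ≠ ∞ := by
    rintro rfl
    rw [EReal.coe_ennreal_top, EReal.sub_top] at h
    exact EReal.coe_ennreal_ne_bot _ h.symm
  lift P to ℝ≥0 using ne_top_of_le_ne_top hT hP
  lift N to ℝ≥0 using hN
  lift T to ℝ≥0 using hT
  have h' : (P : ℝ) - N = T := by
    simp only [EReal.coe_nnreal_eq_coe_real] at h
    exact_mod_cast h
  have hP' : (P : ℝ) ≤ T := by exact_mod_cast hP
  have := N.coe_nonneg
  have hN : N = 0 := NNReal.coe_eq_zero.1 (by linarith)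
  refine ⟨?_, by simp [hN]⟩
  have : (P : ℝ) = T := by linarith
  exact_mod_cast this

/-- The positive part of `h` integrates to at most `∫ c < ∞`, so equality forces the negative part
to vanish and the positive part to equal `c` almost everywhere. -/
lemma ae_eq_of_extIntegral_eq (hh : Measurable h) (hc : Measurable c)
    (hle : ∀ z, h z ≤ ((c z : ℝ) : EReal)) (hfin : ∫⁻ z, (c z : ℝ≥0∞) ∂π ≠ ∞)
    (heq : extIntegral π h = ((∫⁻ z, (c z : ℝ≥0∞) ∂π : ℝ≥0∞) : EReal)) :
    ∀ᵐ z ∂π, h z = ((c z : ℝ) : EReal) := by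
  have hle' : ∀ z, (h z).toENNReal ≤ c z := fun z => by
    simpa using EReal.toENNReal_le_toENNReal (hle z)
  have hP : ∫⁻ z, (h z).toENNReal ∂π ≤ ∫⁻ z, (c z : ℝ≥0∞) ∂π := lintegral_mono hle'
  obtain ⟨hPT, hN⟩ := eq_and_eq_zero_of_coe_sub_coe_eq hP hfin heq
  have hm : Measurable fun z => (-(h z)).toENNReal := hh.neg.ereal_toENNReal
  rw [lintegral_eq_zero_iff hm] at hN
  have hpos := ae_eq_of_ae_le_of_lintegral_le (Eventually.of_forall hle')
    (ne_top_of_le_ne_top hfin hP) hc.coe_nnreal_ennreal.aemeasurable hPT.ge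
  filter_upwards [hN, hpos] with z hz₁ hz₂
  have h0 : 0 ≤ h z := by simpa using EReal.toENNReal_eq_zero_iff.1 hz₁
  rw [← EReal.coe_toENNReal h0, hz₂, EReal.coe_nnreal_eq_coe_real]

end ExtIntegral

/-! ### Potentials characterised by complementary slackness -/

section Slackness

variable {X : Type*} {Y : Type*} [MeasurableSpace X] [MeasurableSpace Y] {c : X × Y → ℝ≥0}
  {f : X → EReal} {μ : Measure X} {ν : Measure Y} {π : Measure (X × Y)}

lemma IsPlan.isFiniteMeasure [IsFiniteMeasure μ] (h : IsPlan μ ν π) : IsFiniteMeasure π :=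
  ⟨by rw [← Measure.fst_univ, h.1]; exact measure_lt_top μ univ⟩

variable [TopologicalSpace X] [TopologicalSpace Y] [BorelSpace X] [BorelSpace Y]

/-- A Kantorovich potential satisfies complementary slackness with every optimal plan. -/
lemma ae_add_cTransform_eq [IsFiniteMeasure μ]
    (hcm : Measurable c) (hc : Continuous c) (hT : transportCost c μ ν < ∞)
    (hf : f ∈ kantorovichPotentials c μ ν) (hπ : IsOptimalPlan c μ ν π) :
    ∀ᵐ z ∂π, f z.1 + cTransform c f z.2 = ((c z : ℝ) : EReal) := by
  obtain ⟨hconc, ρ, hρ, hint⟩ := hf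
  have := hπ.1.isFiniteMeasure
  have := hρ.1.isFiniteMeasure
  have hfm := hconc.measurable hc
  have hgm := measurable_cTransform hc f
  have hfin : ∫⁻ z, (c z : ℝ≥0∞) ∂ρ ≠ ∞ := by rw [hρ.2]; exact hT.ne
  refine ae_eq_cost_of_ae_eq_cost (π := ρ) hcm hfm hgm (hρ.1.1.trans hπ.1.1.symm)
    (hρ.1.2.trans hπ.1.2.symm) hconc.1 (cTransform_ne_top hconc.2.1) (add_cTransform_le c f)
    (ae_eq_of_extIntegral_eq (by fun_prop) hcm (fun z => add_cTransform_le c f z.1 z.2) hfin ?_)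
    hfin (hπ.2.trans hρ.2.symm)
  rw [hint, hρ.2]

/-- Complementary slackness with one plan of finite cost makes a `c`-concave function a Kantorovich
potential. -/
lemma mem_kantorovichPotentials_of_ae_eq [IsFiniteMeasure μ]
    (hcm : Measurable c) (hc : Continuous c) (hπ : IsPlan μ ν π)
    (hfin : ∫⁻ z, (c z : ℝ≥0∞) ∂π ≠ ∞) (hf : IsCConcave c f)
    (heq : ∀ᵐ z ∂π, f z.1 + cTransform c f z.2 = ((c z : ℝ) : EReal)) :
    f ∈ kantorovichPotentials c μ ν := by
  have := hπ.isFiniteMeasure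
  have hopt : ∫⁻ z, (c z : ℝ≥0∞) ∂π = transportCost c μ ν := by
    refine le_antisymm (le_iInf₂ fun π' hπ' => ?_) (iInf₂_le π hπ)
    have := hπ'.isFiniteMeasure
    exact lintegral_cost_le_of_ae_eq hcm (hf.measurable hc) (measurable_cTransform hc f)
      (hπ.1.trans hπ'.1.symm) (hπ.2.trans hπ'.2.symm) hf.1 (cTransform_ne_top hf.2.1)
      (add_cTransform_le c f) heq hfin
  exact ⟨hf, π, ⟨hπ, hopt⟩, by rw [extIntegral_eq_of_ae_eq heq, hopt]⟩

end Slackness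

/-! ### Restricted transport problems -/

section Restriction

variable {X : Type*} {Y : Type*} [MeasurableSpace X] [MeasurableSpace Y]

lemma measurableEmbedding_subtype_prodMap {A : Set X} (hA : MeasurableSet A) :
    MeasurableEmbedding (Prod.map (Subtype.val : A → X) (id : Y → Y)) :=
  (MeasurableEmbedding.subtype_coe hA).prodMap MeasurableEmbedding.id

/-- The normalised restriction of the plan `π` to `A × Y`, as a measure on `A × Y`. -/
noncomputable def restrictedPlan (μ : Measure X) (π : Measure (X × Y)) (A : Set X) :
    Measure (A × Y) :=
  (μ A)⁻¹ • π.comap (Prod.map (Subtype.val : A → X) (id : Y → Y))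

variable {μ : Measure X} {ν : Measure Y} {π : Measure (X × Y)} {A : Set X}

lemma isPlan_restrictedPlan (hA : MeasurableSet A) (hπ : IsPlan μ ν π) :
    IsPlan (restrictedSource μ A) (restrictedTarget μ π A) (restrictedPlan μ π A) := by
  have he := measurableEmbedding_subtype_prodMap (Y := Y) hA
  constructor
  · ext s hs
    have himg : Prod.map (Subtype.val : A → X) (id : Y → Y) '' (Prod.fst ⁻¹' s) =
        Prod.fst ⁻¹' (Subtype.val '' s) := by
      ext ⟨x, y⟩; simp
    rw [Measure.fst_apply hs, restrictedPlan, restrictedSource, Measure.smul_apply,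
      Measure.smul_apply, he.comap_apply, himg,
      (MeasurableEmbedding.subtype_coe hA).comap_apply, ← hπ.1,
      Measure.fst_apply ((MeasurableEmbedding.subtype_coe hA).measurableSet_image.2 hs)]
  · ext s hs
    have himg : Prod.map (Subtype.val : A → X) (id : Y → Y) '' (Prod.snd ⁻¹' s) =
        Prod.snd ⁻¹' s ∩ A ×ˢ univ := by
      ext ⟨x, y⟩; simp [and_comm]
    rw [Measure.snd_apply hs, restrictedPlan, restrictedTarget, Measure.smul_apply,
      Measure.smul_apply, he.comap_apply, himg, Measure.snd_apply hs,
      Measure.restrict_apply (measurable_snd hs)]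

lemma ae_restrictedPlan (hA : MeasurableSet A) {p : X × Y → Prop} (h : ∀ᵐ z ∂π, p z) :
    ∀ᵐ w ∂restrictedPlan μ π A, p (w.1, w.2) := by
  have he := measurableEmbedding_subtype_prodMap (Y := Y) hA
  have h' : ∀ᵐ z ∂(π.comap (Prod.map (Subtype.val : A → X) (id : Y → Y))).map
      (Prod.map Subtype.val id), p z := by
    rw [he.map_comap]
    exact ae_restrict_of_ae h
  exact Measure.ae_smul_measure (he.ae_map_iff.1 h') _

lemma lintegral_restrictedPlan_ne_top {c : X × Y → ℝ≥0} (hA : MeasurableSet A) (hμA : μ A ≠ 0)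
    (hfin : ∫⁻ z, (c z : ℝ≥0∞) ∂π ≠ ∞) :
    ∫⁻ w, (restrictedCost c A w : ℝ≥0∞) ∂restrictedPlan μ π A ≠ ∞ := by
  have he := measurableEmbedding_subtype_prodMap (Y := Y) hA
  rw [restrictedPlan, lintegral_smul_measure, smul_eq_mul]
  refine ENNReal.mul_ne_top (ENNReal.inv_ne_top.2 hμA) (ne_top_of_le_ne_top hfin ?_)
  refine (he.lintegral_map (fun z => (c z : ℝ≥0∞))).symm.le.trans ?_
  rw [he.map_comap]
  exact setLIntegral_le_lintegral _ _

lemma isProbabilityMeasure_restrictedSource [IsFiniteMeasure μ] (hA : MeasurableSet A)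
    (hμA : μ A ≠ 0) : IsProbabilityMeasure (restrictedSource μ A) := by
  constructor
  rw [restrictedSource, Measure.smul_apply, (MeasurableEmbedding.subtype_coe hA).comap_apply,
    image_univ, Subtype.range_coe, smul_eq_mul, ENNReal.inv_mul_cancel hμA (measure_ne_top μ A)]

variable {c : X × Y → ℝ≥0} {f : X → EReal}

lemma measurable_restrictedCost (hc : Measurable c) (A : Set X) :
    Measurable (restrictedCost c A) := by
  unfold restrictedCost; fun_prop

lemma continuous_restrictedCost {X Y : Type*} [TopologicalSpace X] [TopologicalSpace Y]
    {c : X × Y → ℝ≥0} (hc : Continuous c) (A : Set X) : Continuous (restrictedCost c A) := by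
  unfold restrictedCost; fun_prop

variable [TopologicalSpace X] [TopologicalSpace Y] [BorelSpace X] [BorelSpace Y]

/-- Kantorovich potentials restrict to Kantorovich potentials of the restricted problem. -/
lemma restrict_mem_kantorovichPotentials [IsFiniteMeasure μ]
    (hcm : Measurable c) (hc : Continuous c) (hT : transportCost c μ ν < ∞)
    (hf : f ∈ kantorovichPotentials c μ ν) (hπ : IsOptimalPlan c μ ν π) (hA : MeasurableSet A)
    (hμA : μ A ≠ 0) :
    (fun x : A => f x) ∈ kantorovichPotentials (restrictedCost c A) (restrictedSource μ A)
      (restrictedTarget μ π A) := by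
  have hprob := isProbabilityMeasure_restrictedSource hA hμA
  have hplan := isPlan_restrictedPlan hA hπ.1
  have hslack := ae_restrictedPlan (μ := μ) hA (ae_add_cTransform_eq hcm hc hT hf hπ)
  have hne : NeZero (restrictedPlan μ π A) := by
    refine ⟨fun h0 => IsProbabilityMeasure.ne_zero (restrictedSource μ A) ?_⟩
    rw [← hplan.1, h0, Measure.fst_zero]
  -- A point where slackness holds shows that `f` is not identically `-∞` on `A`.
  obtain ⟨w, hw⟩ := hslack.exists
  obtain ⟨g, hg, hfg⟩ := hf.1.2.2
  refine mem_kantorovichPotentials_of_ae_eq (measurable_restrictedCost hcm A)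
    (continuous_restrictedCost hc A) hplan
    (lintegral_restrictedPlan_ne_top hA hμA (by rw [hπ.2]; exact hT.ne))
    ⟨fun x => hf.1.1 x, ⟨w.1, fun h => ?_⟩, g, hg, ?_⟩ ?_
  · simp [h] at hw
  · funext x
    rw [hfg]
    rfl
  · filter_upwards [hslack] with z hz
    refine le_antisymm (add_cTransform_le (restrictedCost c A) (fun x : A => f x) z.1 z.2) (hz.symm.le.trans ?_)
    -- The infimum over `A` dominates that over `X`, so restricting can only increase the transform;
    -- slackness for `f` leaves no room for more.
    exact add_le_add le_rfl (le_iInf fun x : A => iInf_le _ (x : X))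

/-- Uniqueness for the restricted problem gives uniqueness on the corresponding piece. -/
lemma exists_ae_restrict_sub_eq [IsFiniteMeasure μ]
    (hcm : Measurable c) (hc : Continuous c) (hT : transportCost c μ ν < ∞) {f₁ f₂ : X → EReal}
    (hf₁ : f₁ ∈ kantorovichPotentials c μ ν) (hf₂ : f₂ ∈ kantorovichPotentials c μ ν)
    (hπ : IsOptimalPlan c μ ν π) (hA : MeasurableSet A)
    (huniq : RestrictedPotentialsAEUnique c μ π A) :
    ∃ a : ℝ, ∀ᵐ x ∂μ.restrict A, f₁ x - f₂ x = (a : EReal) := by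
  by_cases hμA : μ A = 0
  · exact ⟨0, by simp [Measure.restrict_eq_zero.2 hμA]⟩
  obtain ⟨a, ha⟩ := huniq _ (restrict_mem_kantorovichPotentials hcm hc hT hf₁ hπ hA hμA) _
    (restrict_mem_kantorovichPotentials hcm hc hT hf₂ hπ hA hμA)
  refine ⟨a, (ae_restrict_iff_subtype hA).2 ?_⟩
  exact (Measure.ae_ennreal_smul_measure_iff
    (ENNReal.inv_ne_zero.2 (measure_ne_top μ A))).1 ha

end Restriction

open scoped Function

/-! ### Connected components of the support -/

section Components

variable {Z ι : Type*} [TopologicalSpace Z] {S : Set Z} {C : ι → Set Z}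

namespace IsComponentDecomposition

lemma exists_eq (h : IsComponentDecomposition S C) (i : ι) :
    ∃ x ∈ S, C i = connectedComponentIn S x :=
  h.2.subset (mem_range_self i)

lemma isPreconnected (h : IsComponentDecomposition S C) (i : ι) : IsPreconnected (C i) := by
  obtain ⟨x, -, hx⟩ := h.exists_eq i
  exact hx ▸ isPreconnected_connectedComponentIn

lemma subset (h : IsComponentDecomposition S C) (i : ι) : C i ⊆ S := by
  obtain ⟨x, -, hx⟩ := h.exists_eq i
  exact hx ▸ connectedComponentIn_subset S x

lemma isClosed (h : IsComponentDecomposition S C) (hS : IsClosed S) (i : ι) : IsClosed (C i) := by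
  obtain ⟨x, hxS, hx⟩ := h.exists_eq i
  rw [hx, connectedComponentIn_eq_image hxS]
  exact hS.isClosedEmbedding_subtypeVal.isClosedMap _ isClosed_connectedComponent

lemma exists_mem (h : IsComponentDecomposition S C) {x : Z} (hx : x ∈ S) : ∃ i, x ∈ C i := by
  have : connectedComponentIn S x ∈ range C := h.2.superset ⟨x, hx, rfl⟩
  obtain ⟨i, hi⟩ := this
  exact ⟨i, hi ▸ mem_connectedComponentIn hx⟩

lemma pairwise_disjoint (h : IsComponentDecomposition S C) : Pairwise (Disjoint on C) := by
  intro i j hij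
  refine disjoint_left.2 fun z hi hj => hij (h.1 ?_)
  obtain ⟨x, -, hx⟩ := h.exists_eq i
  obtain ⟨y, -, hy⟩ := h.exists_eq j
  rw [hx] at hi ⊢
  rw [hy] at hj ⊢
  rw [connectedComponentIn_eq hi, connectedComponentIn_eq hj]

end IsComponentDecomposition

lemma IsRealContinuousOn.continuousOn_toReal {g : Z → EReal} (h : IsRealContinuousOn g S) :
    ContinuousOn (fun z => (g z).toReal) S :=
  EReal.continuousOn_toReal.comp h.2 fun z hz => by simpa using h.1 z hz

lemma IsRealContinuousOn.mono {g : Z → EReal} {T : Set Z} (h : IsRealContinuousOn g S)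
    (hT : T ⊆ S) : IsRealContinuousOn g T :=
  ⟨fun z hz => h.1 z (hT hz), h.2.mono hT⟩

/-- A function which is continuous on the support of a measure and takes almost surely finitely
many values is constant on connected subsets of the support. -/
lemma exists_eq_const_of_ae_mem_finite [HereditarilyLindelofSpace Z] [MeasurableSpace Z]
    {ρ : Measure Z} {d : Z → ℝ} {F : Set ℝ} (hF : F.Finite) (hd : ContinuousOn d ρ.support)
    (hae : ∀ᵐ z ∂ρ, d z ∈ F) {P : Set Z} (hP : IsPreconnected P) (hPs : P ⊆ ρ.support) :
    ∃ b, ∀ z ∈ P, d z = b := by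
  -- The right-hand side is closed and of full measure, so it contains the support: `d ∈ F` holds
  -- everywhere there, not just almost everywhere.
  have hsub : ρ.support ⊆ ρ.support ∩ d ⁻¹' F :=
    Measure.support_subset_of_isClosed
      (hd.preimage_isClosed_of_isClosed Measure.isClosed_support hF.isClosed)
      (inter_mem Measure.support_mem_ae hae)
  rcases P.eq_empty_or_nonempty with rfl | ⟨z₀, hz₀⟩
  · exact ⟨0, by simp⟩
  exact ⟨d z₀, fun z hz => hP.constant_of_mapsTo hF.isDiscrete (hd.mono hPs) (fun z hz => (hsub (hPs hz)).2)
    hz hz₀⟩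

end Components

/-! ### Non-degeneracy and labels -/

section Degenerate

lemma measure_eq_tsum_inter {Z κ : Type*} [MeasurableSpace Z] [Countable κ] {ρ : Measure Z}
    {E : κ → Set Z} (hE : ∀ j, MeasurableSet (E j)) (hdisj : Pairwise (Disjoint on E))
    (hcov : ∀ᵐ z ∂ρ, ∃ j, z ∈ E j) {S : Set Z} (hS : MeasurableSet S) :
    ρ S = ∑' j, ρ (S ∩ E j) := by
  rw [← measure_iUnion (fun i j hij => (hdisj hij).mono inter_subset_right inter_subset_right)
    fun j => hS.inter (hE j), ← inter_iUnion]
  refine measure_congr ?_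
  filter_upwards [hcov] with z hz
  refine propext ⟨fun h => ⟨h, mem_iUnion.2 hz⟩, fun h => h.1⟩

variable {X : Type*} {Y : Type*} [MeasurableSpace X] [MeasurableSpace Y] {μ : Measure X}
  {ν : Measure Y} {π : Measure (X × Y)} {ι κ : Type*} {C : ι → Set X} {D : κ → Set Y}

/-- If the plan is not degenerate, then labels of the pieces which agree on every pair of pieces
that exchange mass are almost surely constant. -/
lemma exists_ae_label_eq_of_not_isDegenerate [IsProbabilityMeasure μ] [Countable ι] [Countable κ]
    (hπ : IsPlan μ ν π) (hdeg : ¬ IsDegenerate μ ν C D π)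
    (hC : ∀ i, MeasurableSet (C i)) (hCd : Pairwise (Disjoint on C))
    (hCc : ∀ᵐ x ∂μ, ∃ i, x ∈ C i)
    (hD : ∀ j, MeasurableSet (D j)) (hDd : Pairwise (Disjoint on D))
    (hDc : ∀ᵐ y ∂ν, ∃ j, y ∈ D j) {α : Type*} (a : ι → α) (b : κ → α)
    (h : ∀ i j, a i ≠ b j → π (C i ×ˢ D j) = 0) :
    ∃ r, ∀ᵐ x ∂μ, ∃ i, x ∈ C i ∧ a i = r := by
  have hfst : ∀ i, μ (C i) = ∑' j, π (C i ×ˢ D j) := fun i => by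
    rw [← hπ.1, Measure.fst_apply (hC i)]
    refine measure_eq_tsum_inter (fun j => measurable_snd (hD j))
      (fun j k hjk => (hDd hjk).preimage _) ?_ (measurable_fst (hC i))
    rw [← hπ.2] at hDc
    exact ae_of_ae_map measurable_snd.aemeasurable hDc
  have hsnd : ∀ j, ν (D j) = ∑' i, π (C i ×ˢ D j) := fun j => by
    rw [← hπ.2, Measure.snd_apply (hD j)]
    simp_rw [Set.prod_eq, inter_comm (Prod.fst ⁻¹' _)]
    refine measure_eq_tsum_inter (fun i => measurable_fst (hC i))
      (fun i k hik => (hCd hik).preimage _) ?_ (measurable_snd (hD j))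
    rw [← hπ.1] at hCc
    exact ae_of_ae_map measurable_fst.aemeasurable hCc
  obtain ⟨i₀, hi₀⟩ : ∃ i, μ (C i) ≠ 0 := by
    by_contra! h0
    have hnull : ∀ᵐ x ∂μ, ∀ i, x ∉ C i :=
      ae_all_iff.2 fun i => measure_eq_zero_iff_ae_notMem.1 (h0 i)
    obtain ⟨x, ⟨i, hi⟩, hx⟩ := (hCc.and hnull).exists
    exact hx i hi
  -- All mass leaving the pieces in `I` lands in `J`, and all mass reaching `J` comes from `I`.
  -- These sets would witness degeneracy unless `I` carries full mass.
  set I : Set ι := {i | a i = a i₀}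
  set J : Set κ := {j | b j = a i₀}
  have hI : ∀ i : I, μ (C i) = ∑' j : J, π (C i ×ˢ D j) := fun i => by
    rw [hfst]
    refine (tsum_subtype_eq_of_support_subset fun j hj => ?_).symm
    by_contra hne
    exact hj (h _ _ fun heq => hne (heq.symm.trans i.2))
  have hJ : ∀ j : J, ν (D j) = ∑' i : I, π (C i ×ˢ D j) := fun j => by
    rw [hsnd]
    refine (tsum_subtype_eq_of_support_subset (f := fun i => π (C i ×ˢ D j)) fun i hi => ?_).symm
    by_contra hne
    exact hi (h _ _ fun heq => hne (heq.trans j.2))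
  have h₁ : ∑' i : I, μ (C i) = ∑' i : I, ∑' j : J, π (C i ×ˢ D j) := tsum_congr hI
  have h₂ : ∑' i : I, ∑' j : J, π (C i ×ˢ D j) = ∑' j : J, ν (D j) := by
    rw [ENNReal.tsum_comm]
    exact (tsum_congr hJ).symm
  have hpos : 0 < ∑' i : I, μ (C i) :=
    (pos_iff_ne_zero.2 hi₀).trans_le (ENNReal.le_tsum (f := fun i : I => μ (C i)) ⟨i₀, rfl⟩)
  have hone : 1 ≤ ∑' i : I, μ (C i) := by
    by_contra! hlt
    exact hdeg ⟨I, J, hpos, h₁, h₂, by rwa [← h₂, ← h₁]⟩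
  have hdisj : Pairwise (Disjoint on fun i : I => C i) :=
    fun i j hij => hCd (Subtype.coe_ne_coe.2 hij)
  rw [← measure_iUnion hdisj fun i => hC i] at hone
  refine ⟨a i₀, ?_⟩
  filter_upwards [(mem_ae_iff_prob_eq_one (MeasurableSet.iUnion fun i : I => hC i)).2
    (le_antisymm prob_le_one hone)] with x hx
  obtain ⟨i, hi⟩ := mem_iUnion.1 hx
  exact ⟨i, hi, i.2⟩

end Degenerate

/-- A finite sum forces finite summands, so the default value of `toReal` at `±∞` never enters. -/
lemma toReal_sub_toReal_of_add_eq {x₁ x₂ y₁ y₂ : EReal} {r a : ℝ} (h₁ : x₁ + y₁ = r)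
    (h₂ : x₂ + y₂ = r) (h : x₁ - x₂ = a) : y₁.toReal - y₂.toReal = -a := by
  have key : ∀ {x y : EReal}, x + y = r → ∃ s t : ℝ, x = s ∧ y = t ∧ s + t = r := by
    intro x y hxy
    induction x <;> induction y <;> simp_all
    exact_mod_cast hxy
  obtain ⟨s₁, t₁, rfl, rfl, hr₁⟩ := key h₁
  obtain ⟨s₂, t₂, rfl, rfl, hr₂⟩ := key h₂
  have : s₁ - s₂ = a := by exact_mod_cast h
  simp only [EReal.toReal_coe]
  linarith

end OptTransport

/-! ### The uniqueness theorem -/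

theorem mainTheorem1 {X : Type*} {Y : Type*}
    [TopologicalSpace X] [PolishSpace X] [MeasurableSpace X] [BorelSpace X]
    [TopologicalSpace Y] [PolishSpace Y] [MeasurableSpace Y] [BorelSpace Y]
    (μ : Measure X) [IsProbabilityMeasure μ] (ν : Measure Y) [IsProbabilityMeasure ν]
    (c : X × Y → ℝ≥0) (hc : Continuous c) (hT : OptTransport.transportCost c μ ν < ∞)
    {ι κ : Type*} [Finite ι] [Countable κ] (C : ι → Set X) (D : κ → Set Y)
    (hC : OptTransport.IsComponentDecomposition μ.support C)
    (hD : OptTransport.IsComponentDecomposition ν.support D)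
    (hcont : ∀ f ∈ OptTransport.kantorovichPotentials c μ ν,
      OptTransport.IsRealContinuousOn (OptTransport.cTransform c f) ν.support ∨
      ∀ j, 0 < ν (D j) →
        OptTransport.IsRealContinuousOn (OptTransport.cTransform c f) (D j) ∧
        IsConnected (ν.restrict (D j)).support)
    (hplan : ∃ π : Measure (X × Y), OptTransport.IsOptimalPlan c μ ν π ∧
      ¬ OptTransport.IsDegenerate μ ν C D π ∧
      ∀ i, OptTransport.RestrictedPotentialsAEUnique c μ π (C i)) :
    OptTransport.PotentialsAEUnique c μ ν := by
  intro f₁ hf₁ f₂ hf₂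
  obtain ⟨π, hπ, hdeg, huniq⟩ := hplan
  have hcm : Measurable c := hc.measurable
  have hCm i : MeasurableSet (C i) := (hC.isClosed Measure.isClosed_support i).measurableSet
  have hDcl j : IsClosed (D j) := hD.isClosed Measure.isClosed_support j
  have hDm j : MeasurableSet (D j) := (hDcl j).measurableSet
  have hCc : ∀ᵐ x ∂μ, ∃ i, x ∈ C i := by
    filter_upwards [Measure.support_mem_ae (μ := μ)] with x hx using hC.exists_mem hx
  have hDc : ∀ᵐ y ∂ν, ∃ j, y ∈ D j := by
    filter_upwards [Measure.support_mem_ae (μ := ν)] with y hy using hD.exists_mem hy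
  choose a ha using fun i => OptTransport.exists_ae_restrict_sub_eq hcm hc hT hf₁ hf₂ hπ (hCm i)
    (huniq i)
  have ha' : ∀ᵐ x ∂μ, ∀ i, x ∈ C i → f₁ x - f₂ x = (a i : EReal) :=
    ae_all_iff.2 fun i => (ae_restrict_iff' (hCm i)).1 (ha i)
  have fst_ae {p : X → Prop} (h : ∀ᵐ x ∂μ, p x) : ∀ᵐ z ∂π, p z.1 := by
    rw [← hπ.1.1] at h
    exact ae_of_ae_map measurable_fst.aemeasurable h
  have snd_ae {p : Y → Prop} (h : ∀ᵐ y ∂ν, p y) : ∀ᵐ z ∂π, p z.2 := by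
    rw [← hπ.1.2] at h
    exact ae_of_ae_map measurable_snd.aemeasurable h
  set d : Y → ℝ := fun y =>
    (OptTransport.cTransform c f₁ y).toReal - (OptTransport.cTransform c f₂ y).toReal
  have hdm : Measurable d := (OptTransport.measurable_cTransform hc f₁).ereal_toReal.sub
    (OptTransport.measurable_cTransform hc f₂).ereal_toReal
  have hda : ∀ᵐ z ∂π, ∀ i, z.1 ∈ C i → d z.2 = -a i := by
    filter_upwards [fst_ae ha', OptTransport.ae_add_cTransform_eq hcm hc hT hf₁ hπ,
      OptTransport.ae_add_cTransform_eq hcm hc hT hf₂ hπ] with z hz h₁ h₂ i hi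
    exact OptTransport.toReal_sub_toReal_of_add_eq h₁ h₂ (hz i hi)
  -- Finiteness of `ι` matters here: the set of values must be closed and discrete.
  have hF : (range fun i => -a i).Finite := finite_range _
  have hdF : ∀ᵐ y ∂ν, d y ∈ range fun i => -a i := by
    rw [← hπ.1.2, Measure.snd, ae_map_iff measurable_snd.aemeasurable (hdm hF.measurableSet)]
    filter_upwards [hda, fst_ae hCc] with z hz ⟨i, hi⟩
    exact ⟨i, (hz i hi).symm⟩
  have hb : ∀ j, ∃ b : ℝ, ∀ᵐ y ∂ν.restrict (D j), d y = b := by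
    intro j
    by_cases hj : ν (D j) = 0
    · exact ⟨0, by simp [Measure.restrict_eq_zero.2 hj]⟩
    have hcontOn : ∀ f ∈ OptTransport.kantorovichPotentials c μ ν,
        OptTransport.IsRealContinuousOn (OptTransport.cTransform c f) (D j) := fun f hf =>
      (hcont f hf).elim (fun h => h.mono (hD.subset j)) fun h => (h j (pos_iff_ne_zero.2 hj)).1
    -- Both transforms are continuous on `D j` under either alternative, so connectedness of the
    -- support of `ν|_{D j}` suffices. It is available once one of the two potentials satisfies the
    -- second alternative.
    have of_connected (hK : IsConnected (ν.restrict (D j)).support) :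
        ∃ b : ℝ, ∀ᵐ y ∂ν.restrict (D j), d y = b := by
      have hKD : (ν.restrict (D j)).support ⊆ D j :=
        Measure.support_subset_of_isClosed (hDcl j) (ae_restrict_mem (hDm j))
      obtain ⟨b, hb⟩ := OptTransport.exists_eq_const_of_ae_mem_finite hF
        (((hcontOn f₁ hf₁).mono hKD).continuousOn_toReal.sub
          ((hcontOn f₂ hf₂).mono hKD).continuousOn_toReal) (ae_restrict_of_ae hdF)
        hK.isPreconnected subset_rfl
      exact ⟨b, Filter.mem_of_superset Measure.support_mem_ae hb⟩
    rcases hcont f₁ hf₁ with h₁ | h₁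
    · rcases hcont f₂ hf₂ with h₂ | h₂
      -- Here `d` is continuous on all of `supp ν`, so the connected set `D j` can be used directly,
      -- even if `ν|_{D j}` has smaller support.
      · obtain ⟨b, hb⟩ := OptTransport.exists_eq_const_of_ae_mem_finite hF
          (h₁.continuousOn_toReal.sub h₂.continuousOn_toReal) hdF (hD.isPreconnected j)
          (hD.subset j)
        exact ⟨b, ae_restrict_of_forall_mem (hDm j) hb⟩
      · exact of_connected (h₂ j (pos_iff_ne_zero.2 hj)).2
    · exact of_connected (h₁ j (pos_iff_ne_zero.2 hj)).2
  -- The labels are `a i` and `-b j`: on a pair of pieces exchanging mass, `d` equals both `-a i`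
  -- and `b j` at some point.
  choose b hb using hb
  obtain ⟨r, hr⟩ := OptTransport.exists_ae_label_eq_of_not_isDegenerate hπ.1 hdeg hCm
    hC.pairwise_disjoint hCc hDm hD.pairwise_disjoint hDc a (fun j => -b j) fun i j hij => by
      rw [measure_eq_zero_iff_ae_notMem]
      filter_upwards [hda, snd_ae ((ae_restrict_iff' (hDm j)).1 (hb j))] with z h₁ h₂ hz
      exact hij (by rw [← h₂ hz.2, h₁ i hz.1, neg_neg])
  refine ⟨r, ?_⟩
  filter_upwards [hr, ha'] with x ⟨i, hi, hir⟩ hx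
  rw [hx i hi, hir]
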